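/- **Proposition 3.** For an integral domain $R$ write $R^\times = R\setminus\{0\}$. An isometric representation of $R$ on a complex Hilbert space $\mathcal H$ consists of unitaries $U^n \in B(\mathcal H)$ $(n\in R)$ and isometries $S_r\in B(\mathcal H)$ $(r\in R^\times)$ with $$S_rS_t=S_{rt},\qquad U^nU^m=U^{m+n},\qquad S_rU^n=U^{rn}S_r \qquad (r,t\in R^\times,\ m,n\in R).$$ Let $A(R)$ be the norm closed operator algebra generated by unitaries $u^n$ $(n\in R)$ and isometries $s_r$ $(r\in R^\times)$ that is universal for isometric representations of $R$; that is, the norm closed algebra generated by the families $u^n=(U^n)$ and $s_r=(S_r)$ indexed by all isometric representations, with the supremum norm and the supremum matrix norms. Let $R$ be a field. Let $C^*(R,+)$ be the C\*-algebra of the discrete group $(R,+)$, with canonical unitaries $u_n$ $(n\in R)$. The group $R^\times$ acts on $C^*(R,+)$ by $*$-automorphisms $\alpha_\lambda$ with $\alpha_\lambda(u_n)=u_{\lambda n}$; let $C^*(R,+)\rtimes_\alpha R^\times$ be the (full) C\*-crossed product, $\pi_0$ the canonical map of $C^*(R,+)$ into it, and $\rho_0(r)$ $(r\in R^\times)$ its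 canonical unitaries. Then $A(R)$ is closed under the adjoint, hence a C\*-algebra, and there is an isomorphism $$\Phi : A(R)\;\longrightarrow\; C^*(R,+)\rtimes_\alpha R^\times$$ of algebras that preserves adjoints, is completely isometric, and satisfies $\Phi(u^n)=\pi_0(u_n)$ for all $n\in R$ and $\Phi(s_r)=\rho_0(r)$ for all $r\in R^\times$. -/

import Mathlib

open scoped ENNReal nonZeroDivisors

universe u v w

noncomputable section

/-! ### Bounded families of operators -/

section BoundedFamilies

variable {I : Type*} (H : I → Type*) [∀ i, NormedAddCommGroup (H i)]
  [∀ i, InnerProductSpace ℂ (H i)] [∀ i, CompleteSpace (H i)] [∀ i, Nontrivial (H i)]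

/-- The `ℓ^∞`-product of the algebras `B(H i)`: the bounded families of operators, with pointwise
operations and the supremum norm. It is the algebra of the bounded block-diagonal operators on the
Hilbert space direct sum of the `H i`. -/
def BoundedFamilies : Type _ := lp (fun i => H i →L[ℂ] H i) ∞

namespace BoundedFamilies

instance lpCStarAlgebra : CStarAlgebra (lp (fun i => H i →L[ℂ] H i) ∞) where

instance instCStarAlgebra : CStarAlgebra (BoundedFamilies H) :=
  inferInstanceAs (CStarAlgebra (lp (fun i => H i →L[ℂ] H i) ∞))

variable {H}

/-- The element of the product that is given by a family bounded by `C`. -/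
def mk (f : ∀ i, H i →L[ℂ] H i) (C : ℝ) (hf : ∀ i, ‖f i‖ ≤ C) : BoundedFamilies H :=
  ⟨f, memℓp_infty ⟨C, by rintro _ ⟨i, rfl⟩; exact hf i⟩⟩

/-- The `i`-th coordinate of a family, as a `*`-homomorphism. -/
def eval (i : I) : BoundedFamilies H →⋆ₐ[ℂ] (H i →L[ℂ] H i) where
  toFun x := (show lp (fun i => H i →L[ℂ] H i) ∞ from x) i
  map_one' := rfl
  map_mul' _ _ := rfl
  map_zero' := rfl
  map_add' _ _ := rfl
  commutes' _ := rfl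
  map_star' _ := rfl

@[simp]
theorem eval_mk (f : ∀ i, H i →L[ℂ] H i) (C : ℝ) (hf : ∀ i, ‖f i‖ ≤ C) (i : I) :
    eval i (mk f C hf) = f i := rfl

theorem ext {x y : BoundedFamilies H} (h : ∀ i, eval i x = eval i y) : x = y :=
  lp.ext (funext h)

theorem norm_eval_le (x : BoundedFamilies H) (i : I) : ‖eval i x‖ ≤ ‖x‖ :=
  lp.norm_apply_le_norm ENNReal.top_ne_zero (show lp (fun i => H i →L[ℂ] H i) ∞ from x) i

theorem norm_le {x : BoundedFamilies H} {C : ℝ} (hC : 0 ≤ C) (h : ∀ i, ‖eval i x‖ ≤ C) :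
    ‖x‖ ≤ C :=
  lp.norm_le_of_forall_le hC h

end BoundedFamilies

end BoundedFamilies

theorem opNorm_le_one_of_isometry {H : Type*} [NormedAddCommGroup H] [InnerProductSpace ℂ H]
    {T : H →L[ℂ] H} (hT : Isometry T) : ‖T‖ ≤ 1 :=
  T.opNorm_le_bound zero_le_one fun x => by
    rw [one_mul, ← dist_zero_right, ← dist_zero_right x, ← map_zero T, hT.dist_eq]
    simp

theorem opNorm_le_one_of_mem_unitary {H : Type*} [NormedAddCommGroup H] [InnerProductSpace ℂ H]
    [CompleteSpace H] {T : H →L[ℂ] H} (hT : T ∈ unitary (H →L[ℂ] H)) : ‖T‖ ≤ 1 :=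
  T.opNorm_le_bound zero_le_one fun x => by
    rw [one_mul, ContinuousLinearMap.norm_map_of_mem_unitary hT]

/-! ### Isometric representations of an integral domain and the algebra `A(R)` -/

/-- An isometric representation of the integral domain `R` on a nonzero Hilbert space `H`:
unitaries `U n` for `n ∈ R` and isometries `S r` for `0 ≠ r ∈ R`. (In an integral domain the
multiplicative monoid `R⁰` of the non-zero-divisors consists of the nonzero elements.) The last
relation is the one of the regular representation `U n e_q = e_{q+n}`, `S r e_q = e_{rq}`. -/
structure IsometricRep (R : Type u) [CommRing R] [IsDomain R] : Type (u + 1) where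
  H : Type u
  [instNormedAddCommGroup : NormedAddCommGroup H]
  [instInnerProductSpace : InnerProductSpace ℂ H]
  [instCompleteSpace : CompleteSpace H]
  [instNontrivial : Nontrivial H]
  U : R → H →L[ℂ] H
  S : R⁰ → H →L[ℂ] H
  U_mem_unitary : ∀ n, U n ∈ unitary (H →L[ℂ] H)
  S_isometry : ∀ r, Isometry (S r)
  S_mul_S : ∀ r t, S r * S t = S (r * t)
  U_mul_U : ∀ n m, U n * U m = U (m + n)
  S_mul_U : ∀ (r : R⁰) (n : R), S r * U n = U (r * n) * S r

attribute [instance] IsometricRep.instNormedAddCommGroup IsometricRep.instInnerProductSpace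
  IsometricRep.instCompleteSpace IsometricRep.instNontrivial

namespace DomainAlgebra

variable (R : Type u) [CommRing R] [IsDomain R]

/-- The C*-algebra in which `A(R)` is formed: the `ℓ^∞`-product of the `B(H)` over all isometric
representations of `R`. -/
abbrev Ambient : Type (u + 1) := BoundedFamilies fun ρ : IsometricRep R => ρ.H

variable {R}

/-- The universal unitary `u^n`: the family of the `U n` of all isometric representations. -/
def uFamily (n : R) : Ambient R :=
  BoundedFamilies.mk (fun ρ => ρ.U n) 1 fun ρ => opNorm_le_one_of_mem_unitary (ρ.U_mem_unitary n)

/-- The universal isometry `s_r`: the family of the `S r` of all isometric representations. -/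
def sFamily (r : R⁰) : Ambient R :=
  BoundedFamilies.mk (fun ρ => ρ.S r) 1 fun ρ => opNorm_le_one_of_isometry (ρ.S_isometry r)

end DomainAlgebra

/-- `A(R)`: the norm closed (nonselfadjoint) operator algebra generated by the unitaries `u^n` and
the isometries `s_r` that is universal for the isometric representations of `R`. Its norm is
`‖x‖ = sup ‖ρ(x)‖` over all isometric representations `ρ`. -/
def DomainAlgebra (R : Type u) [CommRing R] [IsDomain R] :
    Subalgebra ℂ (DomainAlgebra.Ambient R) :=
  (Algebra.adjoin ℂ (Set.range DomainAlgebra.uFamily ∪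
    Set.range DomainAlgebra.sFamily)).topologicalClosure

namespace DomainAlgebra

variable {R : Type u} [CommRing R] [IsDomain R]

/-- The generator `u^n` of `A(R)`. -/
def u (n : R) : DomainAlgebra R :=
  ⟨uFamily n, Subalgebra.le_topologicalClosure _
    (Algebra.subset_adjoin (Or.inl (Set.mem_range_self n)))⟩

/-- The generator `s_r` of `A(R)`. -/
def s (r : R⁰) : DomainAlgebra R :=
  ⟨sFamily r, Subalgebra.le_topologicalClosure _
    (Algebra.subset_adjoin (Or.inr (Set.mem_range_self r)))⟩

end DomainAlgebra

/-! ### The C*-algebra of a discrete group -/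

/-- A unitary representation of the discrete group `G` on a nonzero Hilbert space. -/
structure UnitaryRep (G : Type u) [Group G] : Type (u + 1) where
  H : Type u
  [instNormedAddCommGroup : NormedAddCommGroup H]
  [instInnerProductSpace : InnerProductSpace ℂ H]
  [instCompleteSpace : CompleteSpace H]
  [instNontrivial : Nontrivial H]
  U : G →* unitary (H →L[ℂ] H)

attribute [instance] UnitaryRep.instNormedAddCommGroup UnitaryRep.instInnerProductSpace
  UnitaryRep.instCompleteSpace UnitaryRep.instNontrivial

/-- The group algebra `ℂ[G]` (a copy that carries the universal C*-seminorm). -/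
def PreGroupCStar (G : Type u) : Type u := MonoidAlgebra ℂ G

namespace PreGroupCStar

variable {G : Type u} [Group G]

instance : Ring (PreGroupCStar G) := inferInstanceAs (Ring (MonoidAlgebra ℂ G))

instance : Algebra ℂ (PreGroupCStar G) := inferInstanceAs (Algebra ℂ (MonoidAlgebra ℂ G))

/-- The element `c g` of `ℂ[G]`. -/
def single (g : G) (c : ℂ) : PreGroupCStar G := MonoidAlgebra.single g c

theorem single_mul_single (g h : G) (c d : ℂ) :
    single g c * single h d = single (g * h) (c * d) :=
  MonoidAlgebra.single_mul_single ..

theorem one_def : (1 : PreGroupCStar G) = single 1 1 := rfl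

theorem smul_single (a : ℂ) (g : G) (c : ℂ) : a • single g c = single g (a * c) :=
  MonoidAlgebra.smul_single' ..

theorem induction_linear {p : PreGroupCStar G → Prop} (x : PreGroupCStar G) (zero : p 0)
    (add : ∀ x y, p x → p y → p (x + y)) (single : ∀ g c, p (single g c)) : p x :=
  MonoidAlgebra.induction_linear (motive := p) x zero add single

/-- The involution `(∑ c_g g)^* = ∑ conj(c_g) g⁻¹`, as an additive map. -/
def starHom : PreGroupCStar G →+ PreGroupCStar G :=
  MonoidAlgebra.liftNC (R := MonoidAlgebra ℂ G)
    ((MonoidAlgebra.singleAddHom (1 : G)).comp (starRingEnd ℂ : ℂ →+ ℂ))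
    (fun g => MonoidAlgebra.single g⁻¹ 1)

theorem starHom_single (g : G) (c : ℂ) : starHom (single g c) = single g⁻¹ (star c) := by
  refine (MonoidAlgebra.liftNC_single _ _ _ _).trans ?_
  refine (MonoidAlgebra.single_mul_single ..).trans ?_
  simp [single]

instance : StarRing (PreGroupCStar G) where
  star := starHom
  star_involutive x := by
    induction x using induction_linear with
    | zero => simp
    | add x y hx hy => simp [hx, hy]
    | single g c => simp [starHom_single]
  star_add x y := map_add starHom x y
  star_mul x y := by
    induction x using induction_linear with
    | zero => simp
    | add x x' hx hx' => simp [add_mul, mul_add, hx, hx']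
    | single g c =>
      induction y using induction_linear with
      | zero => simp
      | add y y' hy hy' => simp [add_mul, mul_add, hy, hy']
      | single h d => simp [starHom_single, single_mul_single, mul_comm]

theorem star_single (g : G) (c : ℂ) : star (single g c) = single g⁻¹ (star c) :=
  starHom_single g c

instance : StarModule ℂ (PreGroupCStar G) where
  star_smul a x := by
    induction x using induction_linear with
    | zero => simp
    | add x y hx hy => simp [hx, hy]
    | single g c => simp [smul_single, star_single]

/-- The universal unitary representation of `G`, in the `ℓ^∞`-product of the `B(H)` over all
unitary representations of `G`. -/
def univUnitary : G →* BoundedFamilies fun ρ : UnitaryRep G => ρ.H where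
  toFun g := BoundedFamilies.mk (fun ρ => (ρ.U g : ρ.H →L[ℂ] ρ.H)) 1
    fun ρ => opNorm_le_one_of_mem_unitary (ρ.U g).2
  map_one' := by exact BoundedFamilies.ext fun ρ => by simp
  map_mul' g h := by exact BoundedFamilies.ext fun ρ => by simp

/-- The universal representation of `ℂ[G]`. -/
def univ : PreGroupCStar G →ₐ[ℂ] BoundedFamilies fun ρ : UnitaryRep G => ρ.H :=
  MonoidAlgebra.lift ℂ _ G univUnitary

theorem univ_single (g : G) (c : ℂ) : univ (single g c) = c • univUnitary g :=
  MonoidAlgebra.lift_single ..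

theorem univ_star (x : PreGroupCStar G) : univ (star x) = star (univ x) := by
  induction x using induction_linear with
  | zero => simp
  | add x y hx hy => simp [hx, hy]
  | single g c =>
    rw [star_single, univ_single, univ_single, star_smul]
    congr 1
    refine BoundedFamilies.ext fun ρ => ?_
    rw [map_star]
    simp [univUnitary, ← Unitary.star_eq_inv]

/-- The universal C*-seminorm `‖x‖ = sup ‖ρ(x)‖` over all unitary representations `ρ` of `G`. -/
instance : SeminormedRing (PreGroupCStar G) := SeminormedRing.induced _ _ univ

theorem norm_def (x : PreGroupCStar G) : ‖x‖ = ‖univ x‖ := rfl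

instance : NormedSpace ℂ (PreGroupCStar G) where
  norm_smul_le c x := by
    rw [norm_def, map_smul, norm_def]
    exact norm_smul_le c _

theorem norm_star' (x : PreGroupCStar G) : ‖star x‖ = ‖x‖ := by
  rw [norm_def, univ_star, norm_star, norm_def]

theorem norm_star_mul_self' (x : PreGroupCStar G) : ‖star x * x‖ = ‖x‖ * ‖x‖ := by
  rw [norm_def, map_mul, univ_star, CStarRing.norm_star_mul_self, norm_def]

theorem uniformContinuous_star : UniformContinuous (star : PreGroupCStar G → PreGroupCStar G) :=
  (AddMonoidHomClass.isometry_of_norm (starHom : PreGroupCStar G →+ PreGroupCStar G)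
    norm_star').uniformContinuous

end PreGroupCStar

/-- The (full) group C*-algebra `C*(G)` of the discrete group `G`: the completion of `ℂ[G]` in its
universal C*-seminorm. -/
def GroupCStar (G : Type u) [Group G] : Type u :=
  UniformSpace.Completion (PreGroupCStar G)

namespace GroupCStar

open UniformSpace

variable {G : Type u} [Group G]

instance : NormedRing (GroupCStar G) :=
  inferInstanceAs (NormedRing (Completion (PreGroupCStar G)))

instance : CompleteSpace (GroupCStar G) :=
  inferInstanceAs (CompleteSpace (Completion (PreGroupCStar G)))

instance : Algebra ℂ (GroupCStar G) :=
  inferInstanceAs (Algebra ℂ (Completion (PreGroupCStar G)))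

instance : NormedAlgebra ℂ (GroupCStar G) where
  norm_smul_le c x := norm_smul_le (β := Completion (PreGroupCStar G)) c x

/-- The canonical map `ℂ[G] → C*(G)`. -/
def coe : PreGroupCStar G →ₐ[ℂ] GroupCStar G where
  __ := (Completion.coeRingHom : PreGroupCStar G →+* Completion (PreGroupCStar G))
  commutes' _ := rfl

theorem isometry_coe : Isometry (coe : PreGroupCStar G → GroupCStar G) :=
  Completion.coe_isometry

theorem norm_coe (x : PreGroupCStar G) : ‖coe x‖ = ‖x‖ := Completion.norm_coe x

theorem continuous_coe : Continuous (coe : PreGroupCStar G → GroupCStar G) :=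
  isometry_coe.continuous

@[elab_as_elim]
theorem induction_on {p : GroupCStar G → Prop} (x : GroupCStar G)
    (hp : IsClosed {x | p x}) (ih : ∀ x, p (coe x)) : p x :=
  Completion.induction_on x hp ih

instance : Star (GroupCStar G) := ⟨Completion.map star⟩

theorem star_coe (x : PreGroupCStar G) : star (coe x) = coe (star x) :=
  Completion.map_coe PreGroupCStar.uniformContinuous_star x

theorem continuous_star_aux : Continuous (star : GroupCStar G → GroupCStar G) :=
  Completion.continuous_map

instance : StarRing (GroupCStar G) where
  star_involutive x := by
    have h := continuous_star_aux (G := G)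
    refine induction_on x (isClosed_eq (h.comp h) continuous_id) fun x => ?_
    rw [star_coe, star_coe, star_star]
  star_add x y := by
    have h := continuous_star_aux (G := G)
    refine induction_on x (isClosed_eq (h.comp (continuous_add_const y))
      ((continuous_add_const (star y)).comp h)) fun x => ?_
    refine induction_on y (isClosed_eq (h.comp (continuous_const_add _))
      ((continuous_const_add _).comp h)) fun y => ?_
    rw [← map_add, star_coe, star_coe, star_coe, star_add, map_add]
  star_mul x y := by
    have h := continuous_star_aux (G := G)
    refine induction_on x (isClosed_eq (h.comp (continuous_mul_const y))
      ((continuous_const_mul (star y)).comp h)) fun x => ?_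
    refine induction_on y (isClosed_eq (h.comp (continuous_const_mul _))
      ((continuous_mul_const _).comp h)) fun y => ?_
    rw [← map_mul, star_coe, star_coe, star_coe, star_mul, map_mul]

instance : StarModule ℂ (GroupCStar G) where
  star_smul c x := by
    have h := continuous_star_aux (G := G)
    refine induction_on x (isClosed_eq (h.comp (continuous_const_smul c))
      ((continuous_const_smul (star c)).comp h)) fun x => ?_
    rw [← map_smul, star_coe, star_coe, star_smul, map_smul]

instance : CStarRing (GroupCStar G) where
  norm_mul_self_le x := by
    have h := continuous_star_aux (G := G)
    refine induction_on x (isClosed_le (continuous_norm.mul continuous_norm)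
      (continuous_norm.comp (h.mul continuous_id))) fun x => ?_
    rw [star_coe, ← map_mul, norm_coe, norm_coe, PreGroupCStar.norm_star_mul_self']

instance : CStarAlgebra (GroupCStar G) where

/-- The canonical unitary of `C*(G)` that corresponds to `g ∈ G`. -/
def of (g : G) : GroupCStar G := coe (PreGroupCStar.single g 1)

/-- A unitary representation pulled back along a group homomorphism. -/
def _root_.UnitaryRep.comap {G' : Type u} [Group G'] (ρ : UnitaryRep G') (φ : G →* G') :
    UnitaryRep G where
  H := ρ.H
  U := ρ.U.comp φ

/-- The homomorphism `ℂ[G] → ℂ[G']` that extends `φ : G → G'`. -/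
def preMap {G' : Type u} [Group G'] (φ : G →* G') : PreGroupCStar G →ₐ[ℂ] PreGroupCStar G' :=
  MonoidAlgebra.mapDomainAlgHom ℂ ℂ φ

section

variable {G' : Type u} [Group G'] (φ : G →* G')

theorem preMap_single (g : G) (c : ℂ) :
    preMap φ (PreGroupCStar.single g c) = PreGroupCStar.single (φ g) c :=
  MonoidAlgebra.mapDomain_single

theorem preMap_star (x : PreGroupCStar G) : preMap φ (star x) = star (preMap φ x) := by
  induction x using PreGroupCStar.induction_linear with
  | zero => simp
  | add x y hx hy => simp [hx, hy]
  | single g c => simp [PreGroupCStar.star_single, preMap_single]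

theorem eval_univ_preMap (x : PreGroupCStar G) (ρ : UnitaryRep G') :
    BoundedFamilies.eval ρ (PreGroupCStar.univ (preMap φ x)) =
      BoundedFamilies.eval (ρ.comap φ) (PreGroupCStar.univ x) := by
  induction x using PreGroupCStar.induction_linear with
  | zero => simp only [map_zero]; rfl
  | add x y hx hy => simp only [map_add, hx, hy]; rfl
  | single g c =>
    rw [preMap_single, PreGroupCStar.univ_single, PreGroupCStar.univ_single, map_smul, map_smul]
    rfl

theorem norm_preMap_le (x : PreGroupCStar G) : ‖preMap φ x‖ ≤ ‖x‖ := by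
  rw [PreGroupCStar.norm_def]
  refine BoundedFamilies.norm_le (norm_nonneg _) fun ρ => ?_
  rw [eval_univ_preMap]
  exact BoundedFamilies.norm_eval_le (PreGroupCStar.univ x) (ρ.comap φ)

theorem uniformContinuous_preMap : UniformContinuous (preMap φ) :=
  (AddMonoidHomClass.lipschitz_of_bound (preMap φ) 1 fun x => by
    simpa using norm_preMap_le φ x).uniformContinuous

/-- The continuous extension of `preMap φ` to `C*(G)`. -/
def mapFun : GroupCStar G → GroupCStar G' := Completion.map (preMap φ)

theorem mapFun_coe (x : PreGroupCStar G) : mapFun φ (coe x) = coe (preMap φ x) :=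
  Completion.map_coe (uniformContinuous_preMap φ) x

/-- The `*`-homomorphism `C*(G) → C*(G')` induced by a group homomorphism `φ : G → G'`. -/
def map : GroupCStar G →⋆ₐ[ℂ] GroupCStar G' where
  __ := Completion.mapRingHom (preMap φ : PreGroupCStar G →+* PreGroupCStar G')
    (uniformContinuous_preMap φ).continuous
  commutes' c := by
    refine (Completion.map_coe (uniformContinuous_preMap φ) (algebraMap ℂ _ c)).trans ?_
    rw [AlgHom.commutes]
    rfl
  map_star' x := by
    have h : Continuous (mapFun φ) := Completion.continuous_map
    have h' := continuous_star_aux (G := G)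
    have h'' := continuous_star_aux (G := G')
    change mapFun φ (star x) = star (mapFun φ x)
    refine induction_on x (isClosed_eq (h.comp h') (h''.comp h)) fun x => ?_
    rw [star_coe, mapFun_coe, mapFun_coe, preMap_star, star_coe]

theorem map_coe (x : PreGroupCStar G) : map φ (coe x) = coe (preMap φ x) :=
  mapFun_coe φ x

theorem continuous_map : Continuous (map φ) := Completion.continuous_map

theorem map_of (g : G) : map φ (of g) = of (φ g) := by
  rw [of, map_coe, preMap_single, of]

end

theorem hom_ext {B : Type*} [CStarAlgebra B] {f g : GroupCStar G →⋆ₐ[ℂ] B}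
    (hf : Continuous f) (hg : Continuous g) (h : ∀ x, f (of x) = g (of x)) : f = g := by
  ext x
  refine induction_on x (isClosed_eq hf hg) fun x => ?_
  induction x using PreGroupCStar.induction_linear with
  | zero => simp
  | add x y hx hy => simp [hx, hy]
  | single a c =>
    have : PreGroupCStar.single a c = c • PreGroupCStar.single a 1 := by
      rw [PreGroupCStar.smul_single, mul_one]
    rw [this, map_smul, map_smul, map_smul]
    exact congrArg (c • ·) (h a)

theorem map_comp {G' G'' : Type u} [Group G'] [Group G''] (ψ : G' →* G'') (φ : G →* G') :
    (map ψ).comp (map φ) = map (ψ.comp φ) :=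
  hom_ext ((continuous_map ψ).comp (continuous_map φ)) (continuous_map _) fun x => by
    simp [map_of]

theorem map_id : map (MonoidHom.id G) = StarAlgHom.id ℂ (GroupCStar G) :=
  hom_ext (continuous_map _) continuous_id fun x => by simp [map_of]

/-- The action of the automorphisms of `G` on `C*(G)`. -/
def autAction : MulAut G →* (GroupCStar G ≃⋆ₐ[ℂ] GroupCStar G) where
  toFun e := StarAlgEquiv.ofStarAlgHom (map e.toMonoidHom) (map e.symm.toMonoidHom)
    (by rw [map_comp, ← map_id]; congr 1; ext; simp)
    (by rw [map_comp, ← map_id]; congr 1; ext; simp)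
  map_one' := by
    ext x
    exact DFunLike.congr_fun map_id x
  map_mul' e f := by
    ext x
    exact (DFunLike.congr_fun (map_comp e.toMonoidHom f.toMonoidHom) x).symm

end GroupCStar

/-! ### The action of `R^×` on `C*(R,+)` -/

/-- `C*(R,+)`, the C*-algebra of the discrete additive group of `R`. -/
abbrev AddGroupCStar (R : Type u) [Ring R] : Type u := GroupCStar (Multiplicative R)

/-- The unitary of `C*(R,+)` that corresponds to `n ∈ (R,+)`. -/
def AddGroupCStar.u {R : Type u} [Ring R] (n : R) : AddGroupCStar R :=
  GroupCStar.of (Multiplicative.ofAdd n)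

/-- Left multiplication by the units of `R`, as automorphisms of `(R,+)`. -/
def mulLeftAut (R : Type u) [Ring R] : Rˣ →* MulAut (Multiplicative R) where
  toFun l := AddEquiv.toMultiplicative (DistribMulAction.toAddEquiv R l)
  map_one' := by ext x; exact congrArg Multiplicative.ofAdd (one_smul Rˣ x.toAdd)
  map_mul' k l := by ext x; exact congrArg Multiplicative.ofAdd (mul_smul k l x.toAdd)

/-- The action `α` of the group `R^×` on `C*(R,+)` by the automorphisms
`α_λ : u^n ↦ u^{λ n}`. -/
def unitsAction (R : Type u) [Ring R] :
    Rˣ →* (AddGroupCStar R ≃⋆ₐ[ℂ] AddGroupCStar R) :=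
  GroupCStar.autAction.comp (mulLeftAut R)

/-! ### Crossed products by discrete groups -/

section CrossedProduct

variable {A : Type v} [CStarAlgebra A] {G : Type w} [Group G]

/-- A covariant representation `(π, V)` of the C*-dynamical system `(A, G, α)`, with `A` unital and
`G` discrete, on a nonzero Hilbert space. -/
structure CovariantRep (α : G →* (A ≃⋆ₐ[ℂ] A)) : Type (max v w + 1) where
  H : Type (max v w)
  [instNormedAddCommGroup : NormedAddCommGroup H]
  [instInnerProductSpace : InnerProductSpace ℂ H]
  [instCompleteSpace : CompleteSpace H]
  [instNontrivial : Nontrivial H]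
  π : A →⋆ₐ[ℂ] (H →L[ℂ] H)
  V : G →* unitary (H →L[ℂ] H)
  covariant : ∀ (g : G) (a : A),
    π (α g a) = (V g : H →L[ℂ] H) * π a * star (V g : H →L[ℂ] H)

attribute [instance] CovariantRep.instNormedAddCommGroup CovariantRep.instInnerProductSpace
  CovariantRep.instCompleteSpace CovariantRep.instNontrivial

namespace CrossedProduct

variable (α : G →* (A ≃⋆ₐ[ℂ] A))

/-- The C*-algebra in which the crossed product is formed: the `ℓ^∞`-product of the `B(H)` over all
covariant representations. -/
abbrev Ambient : Type (max v w + 1) := BoundedFamilies fun ρ : CovariantRep α => ρ.H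

/-- The universal covariant representation on `A`. -/
def πFamily (a : A) : Ambient α :=
  BoundedFamilies.mk (fun ρ => ρ.π a) ‖a‖ fun ρ => NonUnitalStarAlgHom.norm_apply_le ρ.π a

/-- The universal covariant representation on `G`. -/
def vFamily (g : G) : Ambient α :=
  BoundedFamilies.mk (fun ρ => (ρ.V g : ρ.H →L[ℂ] ρ.H)) 1
    fun ρ => opNorm_le_one_of_mem_unitary (ρ.V g).2

/-- The C*-algebra generated by the universal covariant representation. -/
def subalgebra : StarSubalgebra ℂ (Ambient α) :=
  (StarAlgebra.adjoin ℂ (Set.range (πFamily α) ∪ Set.range (vFamily α))).topologicalClosure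

end CrossedProduct

/-- The (full) crossed product `A ⋊_α G` of a unital C*-algebra `A` by a discrete group `G`: the
C*-algebra generated by the universal covariant representation of `(A, G, α)`. It is the completion
of the finite sums `∑ a_g g` in the norm `sup ‖∑ π(a_g) V_g‖` over all covariant
representations. -/
def CrossedProduct (α : G →* (A ≃⋆ₐ[ℂ] A)) : Type (max v w + 1) :=
  CrossedProduct.subalgebra α

namespace CrossedProduct

variable (α : G →* (A ≃⋆ₐ[ℂ] A))

instance : CStarAlgebra (CrossedProduct α) :=
  StarSubalgebra.cstarAlgebra (subalgebra α)
    (h_closed := StarSubalgebra.isClosed_topologicalClosure _)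

/-- The canonical map `A → A ⋊_α G`. -/
def ι (a : A) : CrossedProduct α :=
  ⟨πFamily α a, StarSubalgebra.le_topologicalClosure _
    (StarAlgebra.subset_adjoin ℂ _ (Or.inl (Set.mem_range_self a)))⟩

/-- The canonical unitaries of `A ⋊_α G`. -/
def v (g : G) : CrossedProduct α :=
  ⟨vFamily α g, StarSubalgebra.le_topologicalClosure _
    (StarAlgebra.subset_adjoin ℂ _ (Or.inr (Set.mem_range_self g)))⟩

end CrossedProduct

end CrossedProduct

/-! ### Complete isometries -/

/-- The C*-norm of a square matrix over a C*-algebra. -/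
def cstarMatrixNorm {B : Type*} [CStarAlgebra B] {k : ℕ} (M : Matrix (Fin k) (Fin k) B) : ℝ :=
  letI := CStarAlgebra.spectralOrder B
  haveI := CStarAlgebra.spectralOrderedRing B
  ‖CStarMatrix.ofMatrix M‖

/-- A map from an algebra of operators `S ⊆ B` to a C*-algebra `C` is completely isometric if it
preserves the norms of the square matrices of every size. -/
def IsCompletelyIsometric {B C : Type*} [CStarAlgebra B] [CStarAlgebra C] {S : Subalgebra ℂ B}
    (Φ : S → C) : Prop :=
  ∀ (k : ℕ) (M : Matrix (Fin k) (Fin k) S),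
    cstarMatrixNorm (M.map Φ) = cstarMatrixNorm (M.map ((↑) : S → B))

end

/-! Over a field, `S r⁻¹` is a right inverse of the isometry `S r`, while the adjoint of `S r` is a
left inverse. The two therefore coincide, and every `S r` is unitary (`IsometricRep.star_S`,
`IsometricRep.S_mem_unitary`). So the adjoint of a generator of A(R) is again a generator, which
makes A(R) selfadjoint.

The relation `S_r U^n = U^{rn} S_r` now reads `S_r U^n S_r^* = U^{rn}`, which is covariance for α on
the generators of C*(R,+). By the universal property of the group C*-algebra, isometric
representations of R and covariant representations of (C*(R,+), R^×, α) are the same data on the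
same Hilbert space: `IsometricRep.toCovariantRep` and `CovariantRep.toIsometricRep`.

Both algebras live in ℓ^∞-products indexed by these representations. Reindexing gives
`*`-homomorphisms `toCrossed` and `ofCrossed` between the products. They match the generators, so by
continuity and density they restrict to mutually inverse maps of the two algebras. As
`*`-homomorphisms contract all matrix norms, the resulting isomorphism is completely isometric. -/

noncomputable section

/-! ### Homomorphisms into products of operator algebras -/

namespace BoundedFamilies

variable {I : Type*} {H : I → Type*} [∀ i, NormedAddCommGroup (H i)]
  [∀ i, InnerProductSpace ℂ (H i)] [∀ i, CompleteSpace (H i)] [∀ i, Nontrivial (H i)]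

/-- The `*`-homomorphism into the `ℓ^∞`-product that is given by its coordinates. -/
def lift {B : Type*} [CStarAlgebra B] (φ : ∀ i, B →⋆ₐ[ℂ] (H i →L[ℂ] H i)) :
    B →⋆ₐ[ℂ] BoundedFamilies H where
  toFun b := mk (fun i => φ i b) ‖b‖ fun i => NonUnitalStarAlgHom.norm_apply_le (φ i) b
  map_one' := ext fun i => map_one (φ i)
  map_mul' x y := ext fun i => map_mul (φ i) x y
  map_zero' := ext fun i => map_zero (φ i)
  map_add' x y := ext fun i => map_add (φ i) x y
  commutes' c := ext fun i => AlgHomClass.commutes (φ i) c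
  map_star' x := ext fun i => map_star (φ i) x

end BoundedFamilies

theorem StarAlgHom.continuous_of_cstarAlgebra {A B : Type*} [CStarAlgebra A] [CStarAlgebra B]
    (f : A →⋆ₐ[ℂ] B) : Continuous f :=
  AddMonoidHomClass.continuous_of_bound f 1 fun x => by
    simpa using NonUnitalStarAlgHom.norm_apply_le f x

/-! ### The universal property of the group C*-algebra -/

namespace PreGroupCStar

variable {G : Type u} [Group G]

/-- The representation of `ℂ[G]` that is given by a unitary representation of `G`. -/
def lift (ρ : UnitaryRep G) : PreGroupCStar G →ₐ[ℂ] (ρ.H →L[ℂ] ρ.H) :=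
  (BoundedFamilies.eval (H := fun ρ : UnitaryRep G => ρ.H) ρ).toAlgHom.comp univ

theorem lift_single_one (ρ : UnitaryRep G) (g : G) :
    lift ρ (single g 1) = (ρ.U g : ρ.H →L[ℂ] ρ.H) := by
  change BoundedFamilies.eval (H := fun ρ : UnitaryRep G => ρ.H) ρ (univ (single g 1)) = _
  rw [univ_single, one_smul]
  rfl

theorem lift_star (ρ : UnitaryRep G) (x : PreGroupCStar G) :
    lift ρ (star x) = star (lift ρ x) := by
  change BoundedFamilies.eval (H := fun ρ : UnitaryRep G => ρ.H) ρ (univ (star x)) = star (BoundedFamilies.eval (H := fun ρ : UnitaryRep G => ρ.H) ρ (univ x))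
  rw [univ_star, map_star]

theorem continuous_lift (ρ : UnitaryRep G) : Continuous (lift ρ) :=
  AddMonoidHomClass.continuous_of_bound (lift ρ) 1 fun x => by
    rw [one_mul]
    exact BoundedFamilies.norm_eval_le (univ x) ρ

end PreGroupCStar

namespace GroupCStar

open UniformSpace

variable {G : Type u} [Group G]

theorem of_one : of (1 : G) = 1 := map_one coe

theorem of_mul (g h : G) : of g * of h = of (g * h) := by
  rw [of, of, of, ← map_mul, PreGroupCStar.single_mul_single, one_mul]

theorem star_of (g : G) : star (of g) = of g⁻¹ := by
  rw [of, of, star_coe, PreGroupCStar.star_single, star_one]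

theorem of_mem_unitary (g : G) : of g ∈ unitary (GroupCStar G) := by
  rw [Unitary.mem_iff, star_of, of_mul, of_mul, inv_mul_cancel, mul_inv_cancel, of_one]
  exact ⟨rfl, rfl⟩

/-- The group elements span ℂ[G], which is dense. No adjoints are needed, so a closed subalgebra
that contains the canonical unitaries is everything. -/
theorem topologicalClosure_adjoin_range_of :
    (Algebra.adjoin ℂ (Set.range (of : G → GroupCStar G))).topologicalClosure = ⊤ := by
  refine eq_top_iff.2 fun x _ => ?_
  refine induction_on x (Subalgebra.isClosed_topologicalClosure _) fun x => ?_
  refine Subalgebra.le_topologicalClosure _ ?_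
  induction x using PreGroupCStar.induction_linear with
  | zero => rw [map_zero]; exact zero_mem _
  | add x y hx hy => rw [map_add]; exact add_mem hx hy
  | single g c =>
    have : PreGroupCStar.single g c = c • PreGroupCStar.single g 1 := by
      rw [PreGroupCStar.smul_single, mul_one]
    rw [this, map_smul]
    exact Subalgebra.smul_mem _ (Algebra.subset_adjoin (Set.mem_range_self g)) c

/-- The representation of `C*(G)` that is given by a unitary representation of `G`. -/
def lift (ρ : UnitaryRep G) : GroupCStar G →⋆ₐ[ℂ] (ρ.H →L[ℂ] ρ.H) :=
  let f : GroupCStar G →+* (ρ.H →L[ℂ] ρ.H) :=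
    Completion.extensionHom (PreGroupCStar.lift ρ : PreGroupCStar G →+* (ρ.H →L[ℂ] ρ.H))
      (PreGroupCStar.continuous_lift ρ)
  have hf (x : PreGroupCStar G) : f (coe x) = PreGroupCStar.lift ρ x :=
    Completion.extensionHom_coe _ (PreGroupCStar.continuous_lift ρ) x
  have hc : Continuous f := Completion.continuous_extension
  { f with
    commutes' c := by
      refine (hf (algebraMap ℂ _ c)).trans ?_
      rw [AlgHom.commutes]
    map_star' x := by
      change f (star x) = star (f x)
      refine induction_on x (isClosed_eq (hc.comp continuous_star_aux)
        (continuous_star.comp hc)) fun x => ?_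
      rw [star_coe, hf, hf, PreGroupCStar.lift_star] }

theorem lift_of (ρ : UnitaryRep G) (g : G) :
    lift ρ (of g) = (ρ.U g : ρ.H →L[ℂ] ρ.H) :=
  (Completion.extensionHom_coe _ (PreGroupCStar.continuous_lift ρ) _).trans
    (PreGroupCStar.lift_single_one ρ g)

end GroupCStar

theorem unitsAction_u {R : Type u} [Ring R] (l : Rˣ) (n : R) :
    unitsAction R l (AddGroupCStar.u n) = AddGroupCStar.u ((l : R) * n) :=
  GroupCStar.map_of _ _

/-! ### The inclusion of the crossed product -/

namespace CrossedProduct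

variable {A : Type v} [CStarAlgebra A] {G : Type w} [Group G] (α : G →* (A ≃⋆ₐ[ℂ] A))

/-- The universal covariant representation on `A`, as a `*`-homomorphism. -/
def πHom : A →⋆ₐ[ℂ] Ambient α := BoundedFamilies.lift fun σ => σ.π

/-- The inclusion of the crossed product in the algebra in which it is formed. -/
def inclusion : CrossedProduct α →⋆ₐ[ℂ] Ambient α := (subalgebra α).subtype

theorem inclusion_injective : Function.Injective (inclusion α) := Subtype.val_injective

end CrossedProduct

/-! ### Isometric representations of a field and covariant representations -/

section Field

variable {R : Type u} [Field R]

namespace IsometricRep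

variable (ρ : IsometricRep R)

theorem S_one : ρ.S 1 = 1 := by
  ext x
  -- `S 1` is idempotent and injective.
  exact (ρ.S_isometry 1).injective (DFunLike.congr_fun (ρ.S_mul_S 1 1) x |>.trans (by simp))

theorem U_zero : ρ.U 0 = 1 := by
  have h := congrArg (star (ρ.U 0) * ·) (ρ.U_mul_U 0 0)
  simpa only [← mul_assoc, Unitary.star_mul_self_of_mem (ρ.U_mem_unitary 0), one_mul, add_zero]
    using h

theorem star_U (n : R) : star (ρ.U n) = ρ.U (-n) :=
  left_inv_eq_right_inv (Unitary.star_mul_self_of_mem (ρ.U_mem_unitary n))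
    (by rw [ρ.U_mul_U, neg_add_cancel, ρ.U_zero])

/-- The place where invertibility in R matters: the adjoint is a left inverse because `S r` is an
isometry, and `S r⁻¹` is a right inverse by multiplicativity. -/
theorem star_S (r : Rˣ) : star (ρ.S (nonZeroDivisorsEquivUnits.symm r)) =
    ρ.S (nonZeroDivisorsEquivUnits.symm r⁻¹) :=
  left_inv_eq_right_inv
    ((ContinuousLinearMap.isometry_iff_adjoint_comp_self _).1 (ρ.S_isometry _))
    (by rw [ρ.S_mul_S, ← map_mul, mul_inv_cancel, map_one, ρ.S_one])

theorem S_mem_unitary (r : Rˣ) :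
    ρ.S (nonZeroDivisorsEquivUnits.symm r) ∈ unitary (ρ.H →L[ℂ] ρ.H) := by
  rw [Unitary.mem_iff, star_S, ρ.S_mul_S, ρ.S_mul_S, ← map_mul, ← map_mul, mul_inv_cancel,
    inv_mul_cancel, map_one, ρ.S_one]
  exact ⟨rfl, rfl⟩

/-- The unitaries `U n` as a representation of the group `(R,+)`. -/
abbrev additiveRep : UnitaryRep (Multiplicative R) where
  H := ρ.H
  U :=
    { toFun := fun n => ⟨ρ.U n.toAdd, ρ.U_mem_unitary _⟩
      map_one' := Subtype.ext ρ.U_zero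
      map_mul' := fun m n => Subtype.ext <| by
        -- `U_mul_U` has the sum in the reversed order.
        rw [toAdd_mul, add_comm]
        exact (ρ.U_mul_U _ _).symm }

/-- The isometries `S r` over a field as a unitary representation of the group `R^×`. -/
def unitsRep : Rˣ →* unitary (ρ.H →L[ℂ] ρ.H) where
  toFun r := ⟨ρ.S (nonZeroDivisorsEquivUnits.symm r), ρ.S_mem_unitary r⟩
  map_one' := Subtype.ext <| (congrArg ρ.S (map_one nonZeroDivisorsEquivUnits.symm)).trans ρ.S_one
  map_mul' r t := Subtype.ext <|
    (congrArg ρ.S (map_mul nonZeroDivisorsEquivUnits.symm r t)).trans (ρ.S_mul_S _ _).symm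

theorem lift_additiveRep_u (n : R) :
    GroupCStar.lift ρ.additiveRep (AddGroupCStar.u n) = ρ.U n :=
  GroupCStar.lift_of ρ.additiveRep _

/-- Both sides are continuous `*`-homomorphisms in `a`, so it suffices to compare them on the
canonical unitaries, where the claim is `U^{gn} = S_g U^n S_g^*`. -/
theorem lift_additiveRep_unitsAction (g : Rˣ) (a : AddGroupCStar R) :
    GroupCStar.lift ρ.additiveRep (unitsAction R g a) =
      (ρ.unitsRep g : ρ.H →L[ℂ] ρ.H) * GroupCStar.lift ρ.additiveRep a *
        star (ρ.unitsRep g : ρ.H →L[ℂ] ρ.H) := by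
  let f : AddGroupCStar R →⋆ₐ[ℂ] (ρ.H →L[ℂ] ρ.H) := (GroupCStar.lift ρ.additiveRep).comp
    (unitsAction R g : AddGroupCStar R →⋆ₐ[ℂ] AddGroupCStar R)
  let f' : AddGroupCStar R →⋆ₐ[ℂ] (ρ.H →L[ℂ] ρ.H) := StarAlgHom.comp
    (StarAlgHomClass.toStarAlgHom (Unitary.conjStarAlgAut ℂ (ρ.H →L[ℂ] ρ.H) (ρ.unitsRep g)))
    (GroupCStar.lift ρ.additiveRep)
  have h : f = f' := by
    refine GroupCStar.hom_ext f.continuous_of_cstarAlgebra f'.continuous_of_cstarAlgebra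
      fun n => ?_
    change GroupCStar.lift ρ.additiveRep (unitsAction R g (AddGroupCStar.u n.toAdd)) =
      ρ.S (nonZeroDivisorsEquivUnits.symm g) *
        GroupCStar.lift ρ.additiveRep (AddGroupCStar.u n.toAdd) *
        star (ρ.S (nonZeroDivisorsEquivUnits.symm g))
    rw [unitsAction_u, lift_additiveRep_u, lift_additiveRep_u, ρ.S_mul_U, mul_assoc,
      Unitary.mul_star_self_of_mem (ρ.S_mem_unitary g), mul_one]
    rfl
  exact DFunLike.congr_fun h a

/-- The covariant representation that is given by an isometric representation of a field. -/
abbrev toCovariantRep : CovariantRep (unitsAction R) where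
  H := ρ.H
  π := GroupCStar.lift ρ.additiveRep
  V := ρ.unitsRep
  covariant := ρ.lift_additiveRep_unitsAction

end IsometricRep

/-- The isometric representation that is given by a covariant representation. -/
abbrev CovariantRep.toIsometricRep (σ : CovariantRep (unitsAction R)) : IsometricRep R where
  H := σ.H
  U n := σ.π (AddGroupCStar.u n)
  S r := (σ.V (nonZeroDivisorsEquivUnits r) : σ.H →L[ℂ] σ.H)
  U_mem_unitary n := Unitary.map_mem σ.π (GroupCStar.of_mem_unitary _)
  S_isometry r := (ContinuousLinearMap.isometry_iff_adjoint_comp_self _).2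
    (Unitary.star_mul_self_of_mem (σ.V (nonZeroDivisorsEquivUnits r)).2)
  S_mul_S r t := by rw [map_mul, map_mul]; rfl
  U_mul_U n m := by
    rw [← map_mul, AddGroupCStar.u, AddGroupCStar.u, GroupCStar.of_mul, ← ofAdd_add, add_comm]
    rfl
  S_mul_U r n := by
    have := σ.covariant (nonZeroDivisorsEquivUnits r) (AddGroupCStar.u n)
    rw [unitsAction_u] at this
    -- Covariance multiplied on the right by the unitary `V`, which cancels its adjoint.
    refine Eq.trans ?_ (congrArg (· * (σ.V (nonZeroDivisorsEquivUnits r) : σ.H →L[ℂ] σ.H))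
      this.symm)
    simp [mul_assoc]

/-! ### Comparison maps between the two ambient products -/

namespace DomainAlgebra

variable (R) in
/-- The representation of the ambient algebra on the space of an isometric representation. -/
abbrev evalRep (ρ : IsometricRep R) : Ambient R →⋆ₐ[ℂ] (ρ.H →L[ℂ] ρ.H) :=
  BoundedFamilies.eval (H := fun ρ : IsometricRep R => ρ.H) ρ

theorem evalRep_uFamily (ρ : IsometricRep R) (n : R) : evalRep R ρ (uFamily n) = ρ.U n := rfl

theorem evalRep_sFamily (ρ : IsometricRep R) (r : R⁰) : evalRep R ρ (sFamily r) = ρ.S r := rfl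

theorem ext_evalRep {x y : Ambient R} (h : ∀ ρ, evalRep R ρ x = evalRep R ρ y) : x = y :=
  BoundedFamilies.ext h

variable (R) in
/-- The `*`-homomorphism between the ambient algebras that pulls back along the passage from
covariant to isometric representations. -/
def toCrossed : Ambient R →⋆ₐ[ℂ] CrossedProduct.Ambient (unitsAction R) :=
  BoundedFamilies.lift fun σ => evalRep R σ.toIsometricRep

variable (R) in
/-- The `*`-homomorphism between the ambient algebras that pulls back along the passage from
isometric to covariant representations. -/
def ofCrossed : CrossedProduct.Ambient (unitsAction R) →⋆ₐ[ℂ] Ambient R :=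
  BoundedFamilies.lift fun ρ => BoundedFamilies.eval
    (H := fun σ : CovariantRep (unitsAction R) => σ.H) ρ.toCovariantRep

theorem toCrossed_uFamily (n : R) :
    toCrossed R (uFamily n) = CrossedProduct.πFamily (unitsAction R) (AddGroupCStar.u n) := rfl

theorem toCrossed_sFamily (r : R⁰) : toCrossed R (sFamily r) =
    CrossedProduct.vFamily (unitsAction R) (nonZeroDivisorsEquivUnits r) := rfl

theorem ofCrossed_πFamily (n : R) :
    ofCrossed R (CrossedProduct.πFamily (unitsAction R) (AddGroupCStar.u n)) = uFamily n :=
  ext_evalRep fun ρ => ρ.lift_additiveRep_u n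

theorem ofCrossed_vFamily (r : Rˣ) :
    ofCrossed R (CrossedProduct.vFamily (unitsAction R) r) =
      sFamily (R := R) (nonZeroDivisorsEquivUnits.symm r) :=
  ext_evalRep fun _ => rfl

/-! ### Selfadjointness of A(R) -/

theorem star_uFamily (n : R) : star (uFamily n) = uFamily (-n) :=
  ext_evalRep fun ρ => by
    rw [map_star, evalRep_uFamily, evalRep_uFamily, ρ.star_U]

theorem star_sFamily (r : Rˣ) : star (sFamily (R := R) (nonZeroDivisorsEquivUnits.symm r)) =
    sFamily (R := R) (nonZeroDivisorsEquivUnits.symm r⁻¹) :=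
  ext_evalRep fun ρ => by
    rw [map_star, evalRep_sFamily, evalRep_sFamily, ρ.star_S]

theorem isClosed : IsClosed (DomainAlgebra R : Set (Ambient R)) :=
  Subalgebra.isClosed_topologicalClosure _

theorem uFamily_mem (n : R) : uFamily n ∈ DomainAlgebra R := (u n).2

theorem sFamily_mem (r : R⁰) : sFamily r ∈ DomainAlgebra R := (s r).2

/-- Induction principle for A(R): a property that defines a closed subalgebra need only be checked
on generators. Indexing the isometries by `Rˣ` makes inverses available. -/
theorem le_of_generators_mem {S : Subalgebra ℂ (Ambient R)} (hS : IsClosed (S : Set (Ambient R)))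
    (hu : ∀ n : R, uFamily n ∈ S)
    (hs : ∀ r : Rˣ, sFamily (R := R) (nonZeroDivisorsEquivUnits.symm r) ∈ S) :
    DomainAlgebra R ≤ S := by
  refine Subalgebra.topologicalClosure_minimal (Algebra.adjoin_le ?_) hS
  rintro _ (⟨n, rfl⟩ | ⟨r, rfl⟩)
  · exact hu n
  · rw [← nonZeroDivisorsEquivUnits.symm_apply_apply r]
    exact hs _

theorem star_mem {a : Ambient R} (ha : a ∈ DomainAlgebra R) : star a ∈ DomainAlgebra R := by
  -- The adjoints of A(R) form a closed subalgebra, so only generators matter.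
  have h : DomainAlgebra R ≤ star (DomainAlgebra R) := by
    refine le_of_generators_mem (isClosed.preimage continuous_star) (fun n => ?_) fun r => ?_
    · rw [Subalgebra.mem_star_iff, star_uFamily]
      exact uFamily_mem _
    · rw [Subalgebra.mem_star_iff, star_sFamily]
      exact sFamily_mem _
  exact h ha

variable (R) in
/-- `A(R)` as a `*`-subalgebra, for a field `R`. -/
def starSubalgebra : StarSubalgebra ℂ (Ambient R) where
  __ := DomainAlgebra R
  star_mem' := star_mem

/-! ### Restriction of the comparison maps to A(R) and the crossed product -/

theorem toCrossed_mem {a : Ambient R} (ha : a ∈ DomainAlgebra R) :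
    toCrossed R a ∈ CrossedProduct.subalgebra (unitsAction R) := by
  let S : Subalgebra ℂ (Ambient R) :=
    (CrossedProduct.subalgebra (unitsAction R)).toSubalgebra.comap (toCrossed R).toAlgHom
  have h : DomainAlgebra R ≤ S := by
    refine le_of_generators_mem ?_ (fun n => ?_) fun r => ?_
    · exact (StarSubalgebra.isClosed_topologicalClosure _).preimage
        (toCrossed R).continuous_of_cstarAlgebra
    · exact (CrossedProduct.ι (unitsAction R) (AddGroupCStar.u n)).2
    · exact (CrossedProduct.v (unitsAction R) _).2
  exact h ha

/-- The crossed product is generated by the image of all of C*(R,+), but that algebra is itself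
generated by the `u_n`, so these and the unitaries of `R^×` suffice. -/
theorem le_of_covariant_generators_mem
    {S : StarSubalgebra ℂ (CrossedProduct.Ambient (unitsAction R))}
    (hS : IsClosed (S : Set (CrossedProduct.Ambient (unitsAction R))))
    (hu : ∀ n : R, CrossedProduct.πFamily (unitsAction R) (AddGroupCStar.u n) ∈ S)
    (hv : ∀ r : Rˣ, CrossedProduct.vFamily (unitsAction R) r ∈ S) :
    CrossedProduct.subalgebra (unitsAction R) ≤ S := by
  refine StarSubalgebra.topologicalClosure_minimal (StarAlgebra.adjoin_le ?_) hS
  rintro _ (⟨a, rfl⟩ | ⟨r, rfl⟩)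
  -- The elements whose image lies in `S` form a closed subalgebra containing every `u_n`.
  · let T : Subalgebra ℂ (AddGroupCStar R) :=
      S.toSubalgebra.comap (CrossedProduct.πHom (unitsAction R)).toAlgHom
    have h : ⊤ ≤ T := by
      rw [← GroupCStar.topologicalClosure_adjoin_range_of]
      refine Subalgebra.topologicalClosure_minimal (Algebra.adjoin_le ?_) ?_
      · rintro _ ⟨n, rfl⟩
        exact hu n.toAdd
      · exact hS.preimage (CrossedProduct.πHom (unitsAction R)).continuous_of_cstarAlgebra
    exact h (Algebra.mem_top (x := a))
  · exact hv r

theorem ofCrossed_mem {x : CrossedProduct.Ambient (unitsAction R)}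
    (hx : x ∈ CrossedProduct.subalgebra (unitsAction R)) :
    ofCrossed R x ∈ DomainAlgebra R := by
  have h : CrossedProduct.subalgebra (unitsAction R) ≤
      (starSubalgebra R).comap (ofCrossed R) := by
    refine le_of_covariant_generators_mem ?_ (fun n => ?_) fun r => ?_
    · exact isClosed.preimage (ofCrossed R).continuous_of_cstarAlgebra
    · rw [StarSubalgebra.mem_comap, ofCrossed_πFamily]
      exact uFamily_mem n
    · rw [StarSubalgebra.mem_comap, ofCrossed_vFamily]
      exact sFamily_mem _
  exact h hx

/-- The set where the composite is the identity is a closed subalgebra. Checking generators avoids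
transport along the non-definitional equality of `ρ` with `ρ.toCovariantRep.toIsometricRep`. -/
theorem ofCrossed_toCrossed {a : Ambient R} (ha : a ∈ DomainAlgebra R) :
    ofCrossed R (toCrossed R a) = a := by
  let S : Subalgebra ℂ (Ambient R) := AlgHom.equalizer
    ((ofCrossed R).comp (toCrossed R)).toAlgHom (AlgHom.id ℂ _)
  have h : DomainAlgebra R ≤ S := by
    refine le_of_generators_mem ?_ (fun n => ?_) fun r => ?_
    · exact isClosed_eq ((ofCrossed R).comp (toCrossed R)).continuous_of_cstarAlgebra
        continuous_id
    · exact ofCrossed_πFamily n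
    · change ofCrossed R (toCrossed R (sFamily _)) = _
      rw [toCrossed_sFamily, ofCrossed_vFamily, MulEquiv.symm_apply_apply]
      rfl
  exact h ha

theorem toCrossed_ofCrossed {x : CrossedProduct.Ambient (unitsAction R)}
    (hx : x ∈ CrossedProduct.subalgebra (unitsAction R)) :
    toCrossed R (ofCrossed R x) = x := by
  have h : CrossedProduct.subalgebra (unitsAction R) ≤
      StarAlgHom.equalizer ((toCrossed R).comp (ofCrossed R)) (StarAlgHom.id ℂ _) := by
    refine le_of_covariant_generators_mem ?_ (fun n => ?_) fun r => ?_
    · exact isClosed_eq ((toCrossed R).comp (ofCrossed R)).continuous_of_cstarAlgebra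
        continuous_id
    · change toCrossed R (ofCrossed R (CrossedProduct.πFamily _ _)) =
        CrossedProduct.πFamily _ _
      rw [ofCrossed_πFamily, toCrossed_uFamily]
    · change toCrossed R (ofCrossed R (CrossedProduct.vFamily _ _)) =
        CrossedProduct.vFamily _ _
      rw [ofCrossed_vFamily, toCrossed_sFamily, MulEquiv.apply_symm_apply]
  exact h hx

variable (R) in
/-- For a field `R`, the isomorphism of `A(R)` with the crossed product of `C*(R,+)` by `R^×`. -/
def equivCrossedProduct : DomainAlgebra R ≃ₐ[ℂ] CrossedProduct (unitsAction R) where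
  toFun a := ⟨toCrossed R a, toCrossed_mem a.2⟩
  invFun x := ⟨ofCrossed R (CrossedProduct.inclusion _ x), ofCrossed_mem x.2⟩
  left_inv a := Subtype.ext (ofCrossed_toCrossed a.2)
  right_inv x := Subtype.ext (toCrossed_ofCrossed x.2)
  map_mul' a b := Subtype.ext (map_mul (toCrossed R) (a : Ambient R) b)
  map_add' a b := Subtype.ext (map_add (toCrossed R) (a : Ambient R) b)
  commutes' c := Subtype.ext (AlgHomClass.commutes (toCrossed R) c)

end DomainAlgebra

end Field

/-! ### Matrix norms -/

section MatrixNorm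

variable {A B : Type*} [CStarAlgebra A] [CStarAlgebra B] {k : ℕ}

/-- Applied entrywise, `f` is a `*`-homomorphism of matrix C*-algebras, hence contractive. -/
theorem cstarMatrixNorm_map_le (f : A →⋆ₐ[ℂ] B) (M : Matrix (Fin k) (Fin k) A) :
    cstarMatrixNorm (M.map f) ≤ cstarMatrixNorm M := by
  let _ := CStarAlgebra.spectralOrder A
  have _ := CStarAlgebra.spectralOrderedRing A
  let _ := CStarAlgebra.spectralOrder B
  have _ := CStarAlgebra.spectralOrderedRing B
  exact NonUnitalStarAlgHom.norm_apply_le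
    (CStarMatrix.mapₙₐ (n := Fin k) (f : A →⋆ₙₐ[ℂ] B)) (CStarMatrix.ofMatrix M)

theorem cstarMatrixNorm_map_of_injective (f : A →⋆ₐ[ℂ] B) (hf : Function.Injective f)
    (M : Matrix (Fin k) (Fin k) A) : cstarMatrixNorm (M.map f) = cstarMatrixNorm M := by
  let _ := CStarAlgebra.spectralOrder A
  have _ := CStarAlgebra.spectralOrderedRing A
  let _ := CStarAlgebra.spectralOrder B
  have _ := CStarAlgebra.spectralOrderedRing B
  exact NonUnitalStarAlgHom.norm_map
    (CStarMatrix.mapₙₐ (n := Fin k) (f : A →⋆ₙₐ[ℂ] B)) (CStarMatrix.map_injective hf)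
    (CStarMatrix.ofMatrix M)

end MatrixNorm

/-! ### Complete isometry and the final statement -/

theorem DomainAlgebra.isCompletelyIsometric_equivCrossedProduct (R : Type u) [Field R] :
    IsCompletelyIsometric (DomainAlgebra.equivCrossedProduct R) := by
  intro k M
  -- Matrix norms over the crossed product may be computed in the ambient product, where the
  -- isomorphism becomes `toCrossed`.
  rw [← cstarMatrixNorm_map_of_injective _
    (CrossedProduct.inclusion_injective (unitsAction R)), Matrix.map_map]
  have h : M.map (CrossedProduct.inclusion _ ∘ equivCrossedProduct R) =
      (M.map ((↑) : DomainAlgebra R → Ambient R)).map (toCrossed R) := rfl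
  rw [h]
  refine le_antisymm (cstarMatrixNorm_map_le _ _) ?_
  -- For the reverse bound, the matrix is recovered from its image by the contraction `ofCrossed`.
  refine le_trans (le_of_eq ?_) (cstarMatrixNorm_map_le (ofCrossed R) _)
  congr 1
  ext i j : 2
  exact (ofCrossed_toCrossed (M i j).2).symm

end

theorem proposition3 (R : Type*) [Field R] :
    (∀ (l : Rˣ) (n : R),
      unitsAction R l (AddGroupCStar.u n) = AddGroupCStar.u ((l : R) * n)) ∧
    (∀ a : DomainAlgebra.Ambient R, a ∈ DomainAlgebra R → star a ∈ DomainAlgebra R) ∧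
    ∃ Φ : DomainAlgebra R ≃ₐ[ℂ] CrossedProduct (unitsAction R),
      (∀ a b : DomainAlgebra R,
        (b : DomainAlgebra.Ambient R) = star (a : DomainAlgebra.Ambient R) →
          Φ b = star (Φ a)) ∧
      IsCompletelyIsometric Φ ∧
      (∀ n : R, Φ (DomainAlgebra.u n) = CrossedProduct.ι (unitsAction R) (AddGroupCStar.u n)) ∧
      (∀ r : Rˣ, Φ (DomainAlgebra.s ((nonZeroDivisorsEquivUnits (G₀ := R)).symm r)) =
        CrossedProduct.v (unitsAction R) r) :=
  ⟨unitsAction_u, fun _ => DomainAlgebra.star_mem, DomainAlgebra.equivCrossedProduct R,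
    -- `DomainAlgebra R` is only a `Subalgebra`, so adjoints are compared in the ambient products,
    -- where `toCrossed` preserves them.
    fun _ _ h => Subtype.ext <|
      (congrArg (DomainAlgebra.toCrossed R) h).trans (map_star (DomainAlgebra.toCrossed R) _),
    DomainAlgebra.isCompletelyIsometric_equivCrossedProduct R, fun _ => rfl,
    fun r => Subtype.ext <| congrArg (CrossedProduct.vFamily (unitsAction R)) <|
      MulEquiv.apply_symm_apply _ r⟩
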